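/- Let $U^1$, $U^2$ and $\mathcal D$ be non-empty finite sets (the actions of player 1, the actions of player 2, and the disturbances), let $l : U^1\times U^2\times \mathcal D\to\mathbb R^L$ be a vector loss, and let $A\subset\mathbb R^L$ be non-empty, closed and convex. In each round $t=1,2,\dots$ player 1 draws $a_t\in U^1$ from a mixed action in the simplex $\Delta(U^1)$ that depends on everything that happened in the rounds before $t$ (a randomized strategy $\sigma$). Simultaneously and, given the past, independently of this draw, player 2's action $b_t\in U^2$ and the disturbance $d_t\in\mathcal D$ are drawn from a joint law that may depend arbitrarily on the same past (a randomized behaviour of the adversary). Put $l_t=l(a_t,b_t,d_t)$, $y_0=0$, $y_1=l_1$ and, for $t\ge1$, $$y_{t+1}=\Bigl(1-\frac1{t+1}\Bigr)y_t+\frac1{t+1}\,l_{t+1}+\frac1{t+1}\,(y_t-y_{t-1}).$$ A strategy $\sigma$ of player 1 makes $y_t$ approach $A$ if, for every behaviour of the adversary, $\lim_{t\to\infty}\operatorname{dist}(y_t,A)=0$ almost surely, where $\operatorname{dist}$ is the Euclidean distance; $A$ is approachable by $y_t$ if player 1 has such a strategy. Write $l(q,b,d)=\sum_{a\in U^1}q(a)\,l(a,b,d)$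 for $q\in\Delta(U^1)$, $w_A(\Lambda)=\sup\{\Lambda\cdot y: y\in A\}\in\mathbb R\cup\{+\infty\}$, and let $P(y)$ be the Euclidean projection of $y$ on $A$. Then the following holds. 1. $A$ is approachable by $y_t$ if and only if for every $\Lambda\in\mathbb R^L$ there is a mixed action $q_\Lambda\in\Delta(U^1)$ such that $$\Lambda\cdot l(q_\Lambda,b,d)\le w_A(\Lambda)\qquad\text{for all } b\in U^2,\ d\in\mathcal D. \tag{$*$}$$ 2. In that case, approachability is achieved by playing these mixed actions. More precisely, let $(q_\Lambda)_{\Lambda\in\mathbb R^L}$ be any family satisfying $(*)$ for every $\Lambda$. Then there are strategies of player 1 that, for every $t\ge1$ with $y_t\notin A$, play in round $t+1$ the mixed action $q_{\Lambda_t}$, where $$\Lambda_t=\frac{y_t-P(y_t)}{\|y_t-P(y_t)\|},$$ and that play arbitrarily in round $1$ and whenever $y_t\in A$; and every such strategy makes $y_t$ approach $A$. -/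

import Mathlib

open MeasureTheory ProbabilityTheory Filter Topology

namespace PerturbedGame

/-- The outcome of one round: player 1's action, player 2's action and the disturbance. -/
@[ext]
structure Round (U₁ U₂ D : Type*) where
  act₁ : U₁
  act₂ : U₂
  dist : D

section Law

variable {U₁ U₂ D : Type*}

/-- Rounds form a finite set; every set of rounds is an event. -/
instance : MeasurableSpace (Round U₁ U₂ D) := ⊤

instance : DiscreteMeasurableSpace (Round U₁ U₂ D) := ⟨fun _ => trivial⟩

instance [Finite U₁] [Finite U₂] [Finite D] : Finite (Round U₁ U₂ D) :=
  Finite.of_injective (fun r => (r.act₁, r.act₂, r.dist)) (by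
    intro r s h
    simp only [Prod.mk.injEq] at h
    exact Round.ext h.1 h.2.1 h.2.2)

/-- A randomized (behaviour) strategy of player 1: after `t` completed rounds, and knowing
everything that happened in them, a mixed action for round `t + 1`. -/
abbrev Strategy (U₁ U₂ D : Type*) [Fintype U₁] :=
  (t : ℕ) → (Fin t → Round U₁ U₂ D) → stdSimplex ℝ U₁

/-- A randomized behaviour of the adversary, i.e. of player 2 together with the disturbance:
after `t` completed rounds, a joint law of the next action of player 2 and the next disturbance.
It may depend on the whole past, but not on player 1's draw in the current round. -/
abbrev Adversary (U₁ U₂ D : Type*) [Fintype U₂] [Fintype D] :=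
  (t : ℕ) → (Fin t → Round U₁ U₂ D) → stdSimplex ℝ (U₂ × D)

variable [Fintype U₁] [Fintype U₂] [Fintype D]

/-- The law of one round when player 1 draws from `p` and, independently, player 2's action and
the disturbance are drawn from `r`. -/
noncomputable def roundLaw (p : stdSimplex ℝ U₁) (r : stdSimplex ℝ (U₂ × D)) :
    Measure (Round U₁ U₂ D) :=
  ∑ a : U₁, ∑ s : U₂ × D, ENNReal.ofReal (p.1 a * r.1 s) • Measure.dirac ⟨a, s.1, s.2⟩

instance (p : stdSimplex ℝ U₁) (r : stdSimplex ℝ (U₂ × D)) :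
    IsProbabilityMeasure (roundLaw p r) := by
  constructor
  have h0 : ∀ a s, 0 ≤ p.1 a * r.1 s := fun a s => mul_nonneg (p.2.1 a) (r.2.1 s)
  have h1 : ∑ a : U₁, ∑ s : U₂ × D, p.1 a * r.1 s = 1 := by
    simp_rw [← Finset.mul_sum]
    rw [r.2.2, ← Finset.sum_mul, p.2.2, one_mul]
  have h2 : (roundLaw p r) Set.univ = ∑ a : U₁, ∑ s : U₂ × D, ENNReal.ofReal (p.1 a * r.1 s) := by
    simp [roundLaw, Measure.finsetSum_apply]
  rw [h2]
  calc ∑ a : U₁, ∑ s : U₂ × D, ENNReal.ofReal (p.1 a * r.1 s)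
      = ∑ a : U₁, ENNReal.ofReal (∑ s : U₂ × D, p.1 a * r.1 s) :=
        Finset.sum_congr rfl fun a _ => (ENNReal.ofReal_sum_of_nonneg fun s _ => h0 a s).symm
    _ = ENNReal.ofReal (∑ a : U₁, ∑ s : U₂ × D, p.1 a * r.1 s) :=
        (ENNReal.ofReal_sum_of_nonneg fun a _ => Finset.sum_nonneg fun s _ => h0 a s).symm
    _ = 1 := by rw [h1, ENNReal.ofReal_one]

/-- The conditional law of the next round given the rounds with (zero-based) indices `0, …, n`. -/
noncomputable def roundKernel (σ : Strategy U₁ U₂ D) (τ : Adversary U₁ U₂ D) (n : ℕ) :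
    Kernel (Π _ : Finset.Iic n, Round U₁ U₂ D) (Round U₁ U₂ D) where
  toFun h :=
    roundLaw (σ (n + 1) fun i => h ⟨i, Finset.mem_Iic.2 (Nat.lt_succ_iff.1 i.2)⟩)
      (τ (n + 1) fun i => h ⟨i, Finset.mem_Iic.2 (Nat.lt_succ_iff.1 i.2)⟩)
  measurable' := Measurable.of_discrete

instance (σ : Strategy U₁ U₂ D) (τ : Adversary U₁ U₂ D) (n : ℕ) :
    IsMarkovKernel (roundKernel σ τ n) :=
  ⟨fun _ => inferInstanceAs (IsProbabilityMeasure (roundLaw _ _))⟩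

/-- The law of the infinite play `ω`, where `ω t` is round number `t + 1`, when player 1 uses `σ`
and the adversary uses `τ`. -/
noncomputable def playLaw (σ : Strategy U₁ U₂ D) (τ : Adversary U₁ U₂ D) :
    Measure (ℕ → Round U₁ U₂ D) :=
  Kernel.trajMeasure (X := fun _ => Round U₁ U₂ D)
    (roundLaw (σ 0 Fin.elim0) (τ 0 Fin.elim0)) (roundKernel σ τ)

end Law

section Iterate

variable {U₁ U₂ D E : Type*} [NormedAddCommGroup E] [InnerProductSpace ℝ E]

/-- The iterate `y_t` along a play: `y₀ = 0`, `y₁ = l₁` and, for `t ≥ 1`,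
`y_{t+1} = (1 - 1/(t+1)) y_t + l_{t+1}/(t+1) + (y_t - y_{t-1})/(t+1)`. -/
noncomputable def iterate (l : U₁ → U₂ → D → E) (ω : ℕ → Round U₁ U₂ D) : ℕ → E
  | 0 => 0
  | 1 => l (ω 0).act₁ (ω 0).act₂ (ω 0).dist
  | t + 2 =>
      (1 - 1 / ((t : ℝ) + 2)) • iterate l ω (t + 1)
        + (1 / ((t : ℝ) + 2)) • l (ω (t + 1)).act₁ (ω (t + 1)).act₂ (ω (t + 1)).dist
        + (1 / ((t : ℝ) + 2)) • (iterate l ω (t + 1) - iterate l ω t)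

/-- The support function `w_A(Λ) = sup {Λ · y : y ∈ A}`, with values in the extended reals. -/
noncomputable def supportFn (A : Set E) (Λ : E) : EReal :=
  ⨆ y ∈ A, ((inner ℝ Λ y : ℝ) : EReal)

variable [Fintype U₁]

/-- The expected loss `l(q, b, d)` when player 1 uses the mixed action `q`. -/
noncomputable def mixedLoss (l : U₁ → U₂ → D → E) (q : stdSimplex ℝ U₁) (b : U₂) (d : D) : E :=
  ∑ a, q.1 a • l a b d

/-- `Λ · l(q, b, d) ≤ w_A(Λ)` for all actions `b` of player 2 and all disturbances `d`. -/
def Enforces (l : U₁ → U₂ → D → E) (A : Set E) (Λ : E) (q : stdSimplex ℝ U₁) : Prop :=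
  ∀ b d, ((inner ℝ Λ (mixedLoss l q b d) : ℝ) : EReal) ≤ supportFn A Λ

/-- `p` is the metric projection of `y` on `A`. -/
def IsProj (A : Set E) (y p : E) : Prop :=
  p ∈ A ∧ ∀ z ∈ A, ‖y - p‖ ≤ ‖y - z‖

/-- `σ` plays in round `t + 1` the mixed action `q Λ_t` with
`Λ_t = (y_t - P(y_t)) / ‖y_t - P(y_t)‖` whenever `t ≥ 1` and `y_t ∉ A`. Nothing is asked of `σ`
when `y_t ∈ A`, nor in the first round. -/
def Follows (l : U₁ → U₂ → D → E) (A : Set E) (q : E → stdSimplex ℝ U₁)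
    (σ : Strategy U₁ U₂ D) : Prop :=
  ∀ (ω : ℕ → Round U₁ U₂ D) (t : ℕ), 1 ≤ t → iterate l ω t ∉ A →
    ∀ p, IsProj A (iterate l ω t) p →
      σ t (fun i => ω i) = q (‖iterate l ω t - p‖⁻¹ • (iterate l ω t - p))

variable [Fintype U₂] [Fintype D]

/-- With the strategy `σ` of player 1, `dist(y_t, A) → 0` almost surely, whatever player 2 and
the disturbance do. -/
def Approaches (l : U₁ → U₂ → D → E) (A : Set E) (σ : Strategy U₁ U₂ D) : Prop :=
  ∀ τ : Adversary U₁ U₂ D, ∀ᵐ ω ∂(playLaw σ τ),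
    Tendsto (fun t => Metric.infDist (iterate l ω t) A) atTop (𝓝 0)

/-- Player 1 has a randomized strategy that makes `y_t` approach `A`. -/
def Approachable (l : U₁ → U₂ → D → E) (A : Set E) : Prop :=
  ∃ σ : Strategy U₁ U₂ D, Approaches l A σ

end Iterate

end PerturbedGame

namespace PerturbedGame

/-! ### Expectations under the law of play. -/

section Law

variable {U₁ U₂ D : Type*} [Fintype U₁] [Fintype U₂] [Fintype D]

/-! The recursion says `y_{t+2} = y_{t+1} + (l_{t+2} - y_t)/(t+2)`: an averaging step whose
subtracted term lags by one round. It telescopes to `(t+1) y_{t+1} - y_t = l_1 + ... + l_{t+1}`, so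
the iterates stay bounded and move by `O(1/t)`; the lag then costs only an error of lower order.

Sufficiency is Blackwell's argument. With `p` the projection of `y_{t+1}`, expanding the square
gives `(t+2) d_{t+2}² ≤ t d_{t+1}² + 2⟨y_{t+1} - p, l_{t+2} - p⟩ + C/(t+1)` for the distances `d`
(`sq_infDist_iterate_le`). The prescribed mixed action makes the conditional mean of the inner
product nonpositive (`Follows.sum_inner_nonpos`), hence `E d_t² = O(1/t)`. This is summable along `t
= k²`, so `d → 0` almost surely there, and the small steps fill the gaps between squares
(`tendsto_infDist_of_squares`).

Necessity: if `(*)` fails for some `Λ`, compactness of the simplex gives a uniform margin `m >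
w_A(Λ)` (`exists_uniform_answer`). An adversary answering the mixed action, which the past reveals
to it, forces `liminf E[Λ · y_t] ≥ m`. Approach would give `E d_t → 0` by dominated convergence,
hence `limsup E[Λ · y_t] ≤ w_A(Λ)`. No minimax theorem is needed. -/

instance (σ : Strategy U₁ U₂ D) (τ : Adversary U₁ U₂ D) :
    IsProbabilityMeasure (playLaw σ τ) := by
  unfold playLaw; infer_instance

theorem exists_eq_comp_frestrictLe {Ω β : Type*} {f : (ℕ → Ω) → β} [Nonempty β] {n : ℕ}
    (hf : DependsOn f (Set.Iic n)) :
    ∃ g : (Finset.Iic n → Ω) → β, ∀ ω, f ω = g (Preorder.frestrictLe (π := fun _ => Ω) n ω) := by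
  obtain ⟨g, hg⟩ := dependsOn_iff_exists_comp.1 hf
  refine ⟨fun h => g fun i => h ⟨i.1, Finset.mem_Iic.2 i.2⟩, fun ω => ?_⟩
  rw [hg]; rfl

/-- The expectation under `roundLaw` is a finite sum. -/
theorem integral_roundLaw (p : stdSimplex ℝ U₁) (r : stdSimplex ℝ (U₂ × D))
    (f : Round U₁ U₂ D → ℝ) :
    ∫ x, f x ∂(roundLaw p r) = ∑ a, ∑ s : U₂ × D, p.1 a * r.1 s * f ⟨a, s.1, s.2⟩ := by
  unfold roundLaw
  have hi : ∀ a (s : U₂ × D), Integrable f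
      (ENNReal.ofReal (p.1 a * r.1 s) • Measure.dirac (⟨a, s.1, s.2⟩ : Round U₁ U₂ D)) :=
    fun a s => (integrable_dirac (by simp)).smul_measure ENNReal.ofReal_ne_top
  rw [integral_finsetSum_measure fun a _ => integrable_finsetSum_measure.2 fun s _ => hi a s]
  refine Finset.sum_congr rfl fun a _ => ?_
  rw [integral_finsetSum_measure fun s _ => hi a s]
  refine Finset.sum_congr rfl fun s _ => ?_
  rw [integral_smul_measure, integral_dirac,
    ENNReal.toReal_ofReal (mul_nonneg (p.2.1 a) (r.2.1 s)), smul_eq_mul]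

/-- A real function of finitely many rounds is integrable. -/
theorem DependsOn.integrable_playLaw (σ : Strategy U₁ U₂ D) (τ : Adversary U₁ U₂ D)
    {f : (ℕ → Round U₁ U₂ D) → ℝ} {n : ℕ} (hf : DependsOn f (Set.Iic n)) :
    Integrable f (playLaw σ τ) := by
  obtain ⟨g, hg⟩ := exists_eq_comp_frestrictLe hf
  obtain rfl : f = g ∘ Preorder.frestrictLe n := funext hg
  obtain ⟨C, hC⟩ := (Set.finite_range fun x => ‖g x‖).bddAbove
  refine Integrable.of_bound (C := C) (Measurable.aestronglyMeasurable
    (Measurable.of_discrete.comp (Preorder.measurable_frestrictLe n))) (.of_forall fun ω => ?_)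
  exact hC ⟨_, rfl⟩

/-- Averaging over the next round, given the past. -/
theorem integral_next_round (σ : Strategy U₁ U₂ D) (τ : Adversary U₁ U₂ D) (n : ℕ)
    {φ : (ℕ → Round U₁ U₂ D) → Round U₁ U₂ D → ℝ} (hφ : DependsOn φ (Set.Iic n)) :
    ∫ ω, φ ω (ω (n + 1)) ∂(playLaw σ τ) =
      ∫ ω, ∑ a, ∑ s : U₂ × D, (σ (n + 1) fun i => ω i).1 a * (τ (n + 1) fun i => ω i).1 s *
        φ ω ⟨a, s.1, s.2⟩ ∂(playLaw σ τ) := by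
  obtain ⟨g, hg⟩ := exists_eq_comp_frestrictLe hφ
  -- The joint law of the past and the next round is the law of the past composed with the round
  -- kernel.
  have key := Kernel.map_frestrictLe_trajMeasure_compProd_eq_map_trajMeasure
    (X := fun _ => Round U₁ U₂ D)
    (μ₀ := roundLaw (σ 0 Fin.elim0) (τ 0 Fin.elim0)) (κ := roundKernel σ τ) (a := n)
  change (playLaw σ τ).map _ ⊗ₘ _ = (playLaw σ τ).map _ at key
  have hm : Measurable fun x : ℕ → Round U₁ U₂ D =>
      (Preorder.frestrictLe (π := fun _ => Round U₁ U₂ D) n x, x (n + 1)) := by fun_prop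
  have hG : Measurable fun z : (Finset.Iic n → Round U₁ U₂ D) × Round U₁ U₂ D => g z.1 z.2 :=
    Measurable.of_discrete
  have e1 : ∫ ω, φ ω (ω (n + 1)) ∂(playLaw σ τ) = ∫ z, g z.1 z.2 ∂((playLaw σ τ).map fun x =>
      (Preorder.frestrictLe (π := fun _ => Round U₁ U₂ D) n x, x (n + 1))) := by
    rw [integral_map hm.aemeasurable hG.aestronglyMeasurable]
    exact integral_congr_ae (.of_forall fun ω => by simp only [hg])
  have := Measure.isProbabilityMeasure_map (μ := playLaw σ τ)
    (Preorder.measurable_frestrictLe (X := fun _ => Round U₁ U₂ D) n).aemeasurable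
  rw [e1, ← key, Measure.integral_compProd (.of_finite),
    integral_map (Preorder.measurable_frestrictLe n).aemeasurable
      (Measurable.of_discrete).aestronglyMeasurable]
  refine integral_congr_ae (.of_forall fun ω => ?_)
  simp only [hg]
  exact integral_roundLaw _ _ _

end Law

/-! ### Distance to a projection and bounded losses. -/

section Projection

variable {U₁ U₂ D E : Type*} [NormedAddCommGroup E]

theorem IsProj.infDist_eq {A : Set E} {y p : E} (h : IsProj A y p) :
    Metric.infDist y A = ‖y - p‖ := by
  refine le_antisymm ((Metric.infDist_le_dist_of_mem h.1).trans_eq (dist_eq_norm _ _)) ?_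
  exact (Metric.le_infDist ⟨p, h.1⟩).2 fun z hz => (h.2 z hz).trans_eq (dist_eq_norm _ _).symm

theorem IsProj.eq_self {A : Set E} {y p : E} (h : IsProj A y p) (hy : y ∈ A) : p = y := by
  have := h.2 y hy
  rw [sub_self, norm_zero, norm_le_zero_iff, sub_eq_zero] at this
  exact this.symm

theorem exists_norm_le_of_finite [Finite U₁] [Finite U₂] [Finite D] (l : U₁ → U₂ → D → E) :
    ∃ M, 0 ≤ M ∧ ∀ a b d, ‖l a b d‖ ≤ M := by
  obtain ⟨M, hM⟩ := (Set.finite_range fun x : U₁ × U₂ × D => ‖l x.1 x.2.1 x.2.2‖).bddAbove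
  exact ⟨max M 0, le_max_right _ _, fun a b d => (hM ⟨(a, b, d), rfl⟩).trans (le_max_left _ _)⟩

end Projection

/-! ### Bounds on the iterates and convex projection. -/

section Iterate

variable {U₁ U₂ D E : Type*} [NormedAddCommGroup E] [InnerProductSpace ℝ E]

/-- The loss incurred in one round. -/
def roundLoss (l : U₁ → U₂ → D → E) (r : Round U₁ U₂ D) : E := l r.act₁ r.act₂ r.dist

theorem iterate_add_two (l : U₁ → U₂ → D → E) (ω : ℕ → Round U₁ U₂ D) (t : ℕ) :
    iterate l ω (t + 2) = iterate l ω (t + 1) +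
      ((t : ℝ) + 2)⁻¹ • (roundLoss l (ω (t + 1)) - iterate l ω t) := by
  rw [iterate, roundLoss]
  module

theorem dependsOn_iterate (l : U₁ → U₂ → D → E) (t : ℕ) :
    DependsOn (fun ω => iterate l ω t) (Set.Iio t) := by
  intro ω ω' h
  induction t using Nat.strong_induction_on with
  | _ t ih =>
    match t with
    | 0 => rfl
    | 1 => simp only [iterate, h 0 (by simp)]
    | t + 2 =>
      simp only [iterate_add_two]
      rw [show iterate l ω (t + 1) = _ from
          ih (t + 1) (by omega) fun i hi => h i (by simp at hi ⊢; omega),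
        show iterate l ω t = _ from ih t (by omega) fun i hi => h i (by simp at hi ⊢; omega),
        h (t + 1) (by simp)]

/-- The vector inside the norm is the sum of the first `t + 1` losses, by telescoping. -/
theorem norm_smul_iterate_sub_le {l : U₁ → U₂ → D → E} {M : ℝ} (hM : ∀ a b d, ‖l a b d‖ ≤ M)
    (ω : ℕ → Round U₁ U₂ D) (t : ℕ) :
    ‖((t : ℝ) + 1) • iterate l ω (t + 1) - iterate l ω t‖ ≤ (t + 1) * M := by
  induction t with
  | zero => simpa [iterate] using hM _ _ _
  | succ t ih =>
    have : ((t + 1 : ℕ) + 1 : ℝ) • iterate l ω (t + 1 + 1) - iterate l ω (t + 1) =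
        (((t : ℝ) + 1) • iterate l ω (t + 1) - iterate l ω t) + roundLoss l (ω (t + 1)) := by
      rw [iterate_add_two, smul_add, smul_smul,
        show ((t + 1 : ℕ) + 1 : ℝ) = t + 2 by push_cast; ring, mul_inv_cancel₀ (by positivity)]
      module
    rw [this]
    refine (norm_add_le _ _).trans ((add_le_add ih (hM _ _ _)).trans_eq ?_)
    push_cast; ring

theorem norm_iterate_le {l : U₁ → U₂ → D → E} {M : ℝ} (h0 : 0 ≤ M) (hM : ∀ a b d, ‖l a b d‖ ≤ M)
    (ω : ℕ → Round U₁ U₂ D) (t : ℕ) : ‖iterate l ω t‖ ≤ 2 * M := by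
  induction t with
  | zero => simpa [iterate] using h0
  | succ t ih =>
    -- Telescoping gives `‖y_{t+1}‖ ≤ M + ‖y_t‖/(t+1)`, which preserves the bound `2M` only when `t
    -- ≥ 1`.
    rcases Nat.eq_zero_or_pos t with rfl | ht
    · have : ‖iterate l ω 1‖ ≤ M := hM _ _ _
      simpa using this.trans (by linarith)
    · have h1 := norm_smul_iterate_sub_le hM ω t
      have h2 := norm_sub_norm_le (((t : ℝ) + 1) • iterate l ω (t + 1)) (iterate l ω t)
      rw [norm_smul, Real.norm_of_nonneg (by positivity)] at h2
      have ht' : (1 : ℝ) ≤ t := by exact_mod_cast ht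
      have : ((t : ℝ) + 1) * ‖iterate l ω (t + 1)‖ ≤ (t + 1) * (2 * M) := by
        nlinarith
      exact le_of_mul_le_mul_left this (by positivity)

theorem norm_iterate_succ_sub_le {l : U₁ → U₂ → D → E} {M : ℝ} (h0 : 0 ≤ M)
    (hM : ∀ a b d, ‖l a b d‖ ≤ M) (ω : ℕ → Round U₁ U₂ D) (t : ℕ) :
    ‖iterate l ω (t + 1) - iterate l ω t‖ ≤ 3 * M / (t + 1) := by
  rw [le_div_iff₀ (by positivity)]
  cases t with
  | zero =>
    have : ‖iterate l ω 1‖ ≤ M := hM _ _ _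
    simpa [iterate] using this.trans (by linarith)
  | succ t =>
    rw [iterate_add_two, add_sub_cancel_left, norm_smul, norm_inv,
      Real.norm_of_nonneg (by positivity), mul_comm,
      show ((t + 1 : ℕ) + 1 : ℝ) = t + 2 by push_cast; ring, mul_inv_cancel_left₀ (by positivity)]
    have h1 : ‖roundLoss l (ω (t + 1))‖ ≤ M := hM _ _ _
    linarith [norm_sub_le (roundLoss l (ω (t + 1))) (iterate l ω t), norm_iterate_le h0 hM ω t]

theorem isProj_iff {A : Set E} (hA : Convex ℝ A) {y p : E} :
    IsProj A y p ↔ p ∈ A ∧ ∀ z ∈ A, inner ℝ (y - p) (z - p) ≤ 0 := by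
  refine and_congr_right fun hp => ?_
  rw [← norm_eq_iInf_iff_real_inner_le_zero hA hp]
  have : Nonempty A := ⟨⟨p, hp⟩⟩
  have hb : BddBelow (Set.range fun w : A => ‖y - w‖) :=
    ⟨0, by rintro _ ⟨w, rfl⟩; exact norm_nonneg _⟩
  constructor
  · intro h
    exact le_antisymm (le_ciInf fun w => h _ w.2) (ciInf_le hb ⟨p, hp⟩)
  · intro h z hz
    rw [h]
    exact ciInf_le hb ⟨z, hz⟩

theorem IsProj.eq {A : Set E} (hA : Convex ℝ A) {y p p' : E} (h : IsProj A y p)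
    (h' : IsProj A y p') : p = p' := by
  have h1 := ((isProj_iff hA).1 h).2 p' h'.1
  have h2 := ((isProj_iff hA).1 h').2 p h.1
  -- Add the variational inequalities of `p` tested at `p'` and of `p'` tested at `p`.
  have h3 : inner ℝ (p - p') (p - p') ≤ (0 : ℝ) := by
    have : inner ℝ (p - p') (p - p') = inner ℝ (y - p) (p' - p) + inner ℝ (y - p') (p - p') := by
      rw [← neg_sub p p', inner_neg_right, neg_add_eq_sub, ← inner_sub_left, sub_sub_sub_cancel_left]
    linarith
  rw [real_inner_self_eq_norm_sq] at h3
  exact sub_eq_zero.1 (norm_eq_zero.1 (pow_eq_zero_iff two_ne_zero |>.1 (le_antisymm h3 (sq_nonneg _))))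

theorem exists_isProj [CompleteSpace E] {A : Set E} (hne : A.Nonempty) (hc : IsClosed A)
    (hA : Convex ℝ A) (y : E) : ∃ p, IsProj A y p := by
  obtain ⟨p, hp, h⟩ := exists_norm_eq_iInf_of_complete_convex hne hc.isComplete hA y
  exact ⟨p, (isProj_iff hA).2 ⟨hp, (norm_eq_iInf_iff_real_inner_le_zero hA hp).1 h⟩⟩

/-- The outward normal at a projection attains the support function there. -/
theorem IsProj.supportFn_le {A : Set E} (hA : Convex ℝ A) {y p : E} (h : IsProj A y p) {c : ℝ}
    (hc : 0 ≤ c) : supportFn A (c • (y - p)) ≤ ((inner ℝ (c • (y - p)) p : ℝ) : EReal) := by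
  refine iSup₂_le fun z hz => EReal.coe_le_coe_iff.2 ?_
  have := ((isProj_iff hA).1 h).2 z hz
  rw [inner_sub_right] at this
  rw [real_inner_smul_left, real_inner_smul_left]
  exact mul_le_mul_of_nonneg_left (by linarith) hc

end Iterate

/-! ### From moment bounds to almost sure convergence. -/

/-- By Tonelli the series of the `f k` has finite integral, so it converges almost everywhere and
its terms vanish. -/
theorem ae_tendsto_zero_of_summable_integral {Ω : Type*} [MeasurableSpace Ω] {μ : Measure Ω}
    {f : ℕ → Ω → ℝ} (hf : ∀ k, Integrable (f k) μ) (h0 : ∀ k ω, 0 ≤ f k ω)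
    (hs : Summable fun k => ∫ ω, f k ω ∂μ) :
    ∀ᵐ ω ∂μ, Tendsto (fun k => f k ω) atTop (𝓝 0) := by
  have h1 : ∀ k, ∫⁻ ω, ENNReal.ofReal (f k ω) ∂μ = ENNReal.ofReal (∫ ω, f k ω ∂μ) := fun k =>
    (ofReal_integral_eq_lintegral_ofReal (hf k) (.of_forall (h0 k))).symm
  have h2 : ∫⁻ ω, ∑' k, ENNReal.ofReal (f k ω) ∂μ ≠ ⊤ := by
    rw [lintegral_tsum fun k => (hf k).1.aemeasurable.ennreal_ofReal]
    simp_rw [h1]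
    exact hs.tsum_ofReal_ne_top
  have hm : AEMeasurable (fun ω => ∑' k, ENNReal.ofReal (f k ω)) μ :=
    AEMeasurable.tsum fun k => (hf k).1.aemeasurable.ennreal_ofReal
  filter_upwards [ae_lt_top' hm h2] with ω hω
  have h3 := (ENNReal.tendsto_toReal ENNReal.zero_ne_top).comp
    (ENNReal.tendsto_atTop_zero_of_tsum_ne_top hω.ne)
  simpa [Function.comp_def, ENNReal.toReal_ofReal, h0] using h3

/-- If the distance to `A` vanishes along the squares and the steps are of order `1 / t`, then
it vanishes along the whole sequence. -/
theorem tendsto_infDist_of_squares {E : Type*} [NormedAddCommGroup E] {y : ℕ → E} {A : Set E} {C : ℝ} (hC : 0 ≤ C)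
    (hstep : ∀ t : ℕ, ‖y (t + 1) - y t‖ ≤ C / (t + 1))
    (hsq : Tendsto (fun k : ℕ => Metric.infDist (y ((k + 1) ^ 2)) A) atTop (𝓝 0)) :
    Tendsto (fun t => Metric.infDist (y t) A) atTop (𝓝 0) := by
  have hgap : ∀ s m : ℕ, 0 < s → ‖y (s + m) - y s‖ ≤ m * (C / s) := by
    intro s m hs
    induction m with
    | zero => simp
    | succ m ih =>
      have h1 : C / ((s + m : ℕ) + 1 : ℝ) ≤ C / s :=
        div_le_div_of_nonneg_left hC (by positivity) (by push_cast; linarith [Nat.cast_nonneg (α := ℝ) m])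
      have h2 := norm_sub_le_norm_sub_add_norm_sub (y (s + (m + 1))) (y (s + m)) (y s)
      have h3 := hstep (s + m)
      rw [add_assoc] at h3
      push_cast
      linarith
  have hle : ∀ t : ℕ, 0 < t → Metric.infDist (y t) A ≤
      Metric.infDist (y (t.sqrt ^ 2)) A + 2 * C / (t.sqrt : ℝ) := by
    intro t ht
    have hk : 0 < t.sqrt := Nat.sqrt_pos.2 ht
    obtain ⟨m, hm⟩ := Nat.exists_eq_add_of_le (Nat.sqrt_le' t)
    -- Past the last square `k²` there are at most `2k` steps, each of size at most `C/k²`.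
    have hm2 : m ≤ 2 * t.sqrt := by
      have := Nat.sqrt_le_add t
      rw [← pow_two] at this
      omega
    have h1 := hgap (t.sqrt ^ 2) m (by positivity)
    rw [← hm] at h1
    have h2 := Metric.infDist_le_infDist_add_dist (s := A) (x := y t) (y := y (t.sqrt ^ 2))
    rw [dist_eq_norm] at h2
    have h3 : (m : ℝ) * (C / (t.sqrt ^ 2 : ℕ)) ≤ 2 * C / (t.sqrt : ℝ) := by
      have hk' : (0 : ℝ) < t.sqrt := by exact_mod_cast hk
      calc (m : ℝ) * (C / (t.sqrt ^ 2 : ℕ)) ≤ (2 * t.sqrt) * (C / (t.sqrt ^ 2 : ℕ)) := by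
            refine mul_le_mul_of_nonneg_right (by exact_mod_cast hm2) (by positivity)
        _ = 2 * C / (t.sqrt : ℝ) := by push_cast; field_simp
    linarith
  have hsqrt : Tendsto Nat.sqrt atTop atTop :=
    tendsto_atTop.2 fun b => (eventually_ge_atTop (b * b)).mono fun t ht => Nat.le_sqrt.2 ht
  have hsq' : Tendsto (fun k : ℕ => Metric.infDist (y (k ^ 2)) A) atTop (𝓝 0) :=
    (tendsto_add_atTop_iff_nat (f := fun k : ℕ => Metric.infDist (y (k ^ 2)) A) 1).1 hsq
  have hlim : Tendsto (fun t : ℕ => Metric.infDist (y (t.sqrt ^ 2)) A + 2 * C / (t.sqrt : ℝ))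
      atTop (𝓝 0) := by
    have := (hsq'.comp hsqrt).add ((tendsto_const_div_atTop_nhds_zero_nat (2 * C)).comp hsqrt)
    simpa [Function.comp_def] using this
  exact tendsto_of_tendsto_of_tendsto_of_le_of_le' tendsto_const_nhds hlim
    (.of_forall fun _ => Metric.infDist_nonneg) ((eventually_gt_atTop 0).mono hle)

/-! ### Sufficiency: Blackwell's strategy. -/

section Sufficiency

variable {U₁ U₂ D E : Type*} [NormedAddCommGroup E] [InnerProductSpace ℝ E]

theorem iterate_succ_congr (l : U₁ → U₂ → D → E) {ω ω' : ℕ → Round U₁ U₂ D} {n : ℕ}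
    (h : ∀ i ∈ Set.Iic n, ω i = ω' i) : iterate l ω (n + 1) = iterate l ω' (n + 1) :=
  dependsOn_iterate l (n + 1) fun i hi => h i (Nat.lt_succ_iff.1 hi)

theorem dependsOn_comp_iterate {β : Type*} (l : U₁ → U₂ → D → E) (f : E → β) (n : ℕ) :
    DependsOn (fun ω => f (iterate l ω n)) (Set.Iic n) := fun _ _ h =>
  congrArg f (dependsOn_iterate l n fun i hi => h i (le_of_lt (Set.mem_Iio.1 hi)))

/-- One step of the iteration, compared with the projection of the current point. -/
theorem sq_infDist_iterate_le {l : U₁ → U₂ → D → E} {A : Set E} {M R : ℝ} (h0 : 0 ≤ M)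
    (hM : ∀ a b d, ‖l a b d‖ ≤ M) (ω : ℕ → Round U₁ U₂ D) (t : ℕ) {p : E}
    (hp : IsProj A (iterate l ω (t + 1)) p) (hR : ‖iterate l ω (t + 1) - p‖ ≤ R) :
    ((t : ℝ) + 2) * Metric.infDist (iterate l ω (t + 2)) A ^ 2 ≤
      t * Metric.infDist (iterate l ω (t + 1)) A ^ 2
      + 2 * inner ℝ (iterate l ω (t + 1) - p) (roundLoss l (ω (t + 1)) - p)
      + (6 * M * R + 9 * M ^ 2) / (t + 1) := by
  have hstep := norm_iterate_succ_sub_le h0 hM ω t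
  have hy := norm_iterate_le h0 hM ω t
  have hrec := iterate_add_two l ω t
  rw [hp.infDist_eq]
  set y := iterate l ω (t + 1)
  set y₀ := iterate l ω t
  set z := roundLoss l (ω (t + 1))
  have hz : ‖z‖ ≤ M := hM _ _ _
  have hd : Metric.infDist (iterate l ω (t + 2)) A ^ 2 ≤
      ‖(y - p) + ((t : ℝ) + 2)⁻¹ • (z - y₀)‖ ^ 2 := by
    refine pow_le_pow_left₀ Metric.infDist_nonneg ?_ 2
    refine (Metric.infDist_le_dist_of_mem hp.1).trans_eq ?_
    rw [dist_eq_norm, hrec, add_sub_right_comm]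
  rw [norm_add_sq_real, inner_smul_right, norm_smul, norm_inv,
    Real.norm_of_nonneg (by positivity : (0 : ℝ) ≤ t + 2)] at hd
  -- Split `z - y₀ = (z - p) - (y - p) + (y - y₀)`. The middle term lowers the coefficient of the
  -- squared distance from `t + 2` to `t`; the last is the lag, of order `1/t`.
  have hin : inner ℝ (y - p) (z - y₀) =
      inner ℝ (y - p) (z - p) - ‖y - p‖ ^ 2 + inner ℝ (y - p) (y - y₀) := by
    rw [← real_inner_self_eq_norm_sq, ← inner_sub_right, ← inner_add_right]
    congr 1; abel
  have hR0 : 0 ≤ R := (norm_nonneg _).trans hR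
  have hcs : inner ℝ (y - p) (y - y₀) ≤ R * (3 * M / (t + 1)) :=
    (real_inner_le_norm _ _).trans (mul_le_mul hR hstep (norm_nonneg _) hR0)
  have hzy : ‖z - y₀‖ ≤ 3 * M := (norm_sub_le _ _).trans (by linarith)
  have hsq : ((t : ℝ) + 2)⁻¹ * ‖z - y₀‖ ^ 2 ≤ 9 * M ^ 2 / (t + 1) := by
    have h1 : ‖z - y₀‖ ^ 2 ≤ 9 * M ^ 2 := by nlinarith [norm_nonneg (z - y₀)]
    rw [inv_mul_eq_div]
    exact div_le_div₀ (by positivity) h1 (by positivity) (by linarith)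
  have hmul := mul_le_mul_of_nonneg_left hd (by positivity : (0 : ℝ) ≤ t + 2)
  have hexp : ((t : ℝ) + 2) * (‖y - p‖ ^ 2 + 2 * (((t : ℝ) + 2)⁻¹ * inner ℝ (y - p) (z - y₀)) +
      (((t : ℝ) + 2)⁻¹ * ‖z - y₀‖) ^ 2) = (t + 2) * ‖y - p‖ ^ 2 + 2 * inner ℝ (y - p) (z - y₀) +
      ((t : ℝ) + 2)⁻¹ * ‖z - y₀‖ ^ 2 := by
    field_simp
  rw [hexp, hin] at hmul
  have hsplit : (6 * M * R + 9 * M ^ 2) / ((t : ℝ) + 1) =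
      2 * (R * (3 * M / (t + 1))) + 9 * M ^ 2 / (t + 1) := by ring
  rw [hsplit]
  linarith

variable [Fintype U₁]

theorem exists_follows [CompleteSpace E] [Nonempty (Round U₁ U₂ D)] {A : Set E}
    (hne : A.Nonempty) (hc : IsClosed A)
    (hA : Convex ℝ A) (l : U₁ → U₂ → D → E) (q : E → stdSimplex ℝ U₁) :
    ∃ σ : Strategy U₁ U₂ D, Follows l A q σ := by
  choose P hP using exists_isProj hne hc hA
  -- The filler rounds are harmless, because `y_t` depends only on the first `t` rounds.
  let ext (t : ℕ) (h : Fin t → Round U₁ U₂ D) : ℕ → Round U₁ U₂ D :=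
    fun i => if hi : i < t then h ⟨i, hi⟩ else Classical.arbitrary _
  let y (t : ℕ) (h : Fin t → Round U₁ U₂ D) : E := iterate l (ext t h) t
  refine ⟨fun t h => q (‖y t h - P (y t h)‖⁻¹ • (y t h - P (y t h))), fun ω t _ _ p hp => ?_⟩
  have hy : y t (fun i => ω i) = iterate l ω t :=
    dependsOn_iterate l t fun i hi => dif_pos (Set.mem_Iio.1 hi)
  simp only [hy, (hP _).eq hA hp]

variable [Fintype U₂] [Fintype D]

theorem Enforces.sum_inner_le {l : U₁ → U₂ → D → E} {A : Set E} {Λ : E} {q : stdSimplex ℝ U₁}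
    (h : Enforces l A Λ q) {w : ℝ} (hw : supportFn A Λ ≤ w) (r : stdSimplex ℝ (U₂ × D)) :
    ∑ a, ∑ s : U₂ × D, q.1 a * r.1 s * inner ℝ Λ (l a s.1 s.2) ≤ w := by
  have h1 : ∀ s : U₂ × D, ∑ a, q.1 a * inner ℝ Λ (l a s.1 s.2) ≤ w := fun s => by
    have := EReal.coe_le_coe_iff.1 ((h s.1 s.2).trans hw)
    simpa only [mixedLoss, inner_sum, inner_smul_right] using this
  calc ∑ a, ∑ s : U₂ × D, q.1 a * r.1 s * inner ℝ Λ (l a s.1 s.2)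
      = ∑ s : U₂ × D, r.1 s * ∑ a, q.1 a * inner ℝ Λ (l a s.1 s.2) := by
        rw [Finset.sum_comm]
        refine Finset.sum_congr rfl fun s _ => ?_
        rw [Finset.mul_sum]
        exact Finset.sum_congr rfl fun a _ => by ring
    _ ≤ ∑ s : U₂ × D, r.1 s * w :=
        Finset.sum_le_sum fun s _ => mul_le_mul_of_nonneg_left (h1 s) (r.2.1 s)
    _ = w := by rw [← Finset.sum_mul, r.2.2, one_mul]

theorem sum_mul_eq_one (p : stdSimplex ℝ U₁) (r : stdSimplex ℝ (U₂ × D)) :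
    ∑ a, ∑ s : U₂ × D, p.1 a * r.1 s = 1 := by
  simp_rw [← Finset.mul_sum]
  rw [r.2.2, ← Finset.sum_mul, p.2.2, one_mul]

/-- Blackwell's condition: the expected next loss is on the far side of the supporting
hyperplane at the projection. -/
theorem Follows.sum_inner_nonpos {l : U₁ → U₂ → D → E} {A : Set E} (hA : Convex ℝ A)
    {q : E → stdSimplex ℝ U₁} (hq : ∀ Λ, Enforces l A Λ (q Λ)) {σ : Strategy U₁ U₂ D}
    (hσ : Follows l A q σ) (ω : ℕ → Round U₁ U₂ D) {t : ℕ} (ht : 1 ≤ t) {p : E}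
    (hp : IsProj A (iterate l ω t) p) (r : stdSimplex ℝ (U₂ × D)) :
    ∑ a, ∑ s : U₂ × D, (σ t fun i => ω i).1 a * r.1 s *
      inner ℝ (iterate l ω t - p) (l a s.1 s.2 - p) ≤ 0 := by
  -- Inside `A` the vector `y_t - p` is zero, so any mixed action will do.
  by_cases hy : iterate l ω t ∈ A
  · simp [hp.eq_self hy]
  · rw [hσ ω t ht hy p hp]
    set v := iterate l ω t - p
    have hv : 0 < ‖v‖ := norm_pos_iff.2 fun h => hy (sub_eq_zero.1 h ▸ hp.1)
    have h1 := (hq (‖v‖⁻¹ • v)).sum_inner_le (hp.supportFn_le hA (inv_nonneg.2 hv.le)) r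
    have h2 := sum_mul_eq_one (q (‖v‖⁻¹ • v)) r
    have h3 : ∑ a, ∑ s : U₂ × D, (q (‖v‖⁻¹ • v)).1 a * r.1 s * inner ℝ v (l a s.1 s.2 - p) =
        ‖v‖ * (∑ a, ∑ s : U₂ × D, (q (‖v‖⁻¹ • v)).1 a * r.1 s *
          inner ℝ (‖v‖⁻¹ • v) (l a s.1 s.2)) - inner ℝ v p *
        ∑ a, ∑ s : U₂ × D, (q (‖v‖⁻¹ • v)).1 a * r.1 s := by
      simp only [Finset.mul_sum, ← Finset.sum_sub_distrib]
      refine Finset.sum_congr rfl fun a _ => Finset.sum_congr rfl fun s _ => ?_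
      rw [inner_sub_right, real_inner_smul_left]
      field_simp
    rw [h3, h2]
    have h4 := mul_le_mul_of_nonneg_left h1 hv.le
    rw [real_inner_smul_left, mul_inv_cancel_left₀ hv.ne'] at h4
    linarith

theorem Follows.exists_integral_sq_infDist_le [CompleteSpace E] {l : U₁ → U₂ → D → E}
    {A : Set E} (hne : A.Nonempty) (hc : IsClosed A) (hA : Convex ℝ A)
    {q : E → stdSimplex ℝ U₁} (hq : ∀ Λ, Enforces l A Λ (q Λ)) {σ : Strategy U₁ U₂ D}
    (hσ : Follows l A q σ) (τ : Adversary U₁ U₂ D) :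
    ∃ K : ℝ, ∀ t : ℕ,
      ((t : ℝ) + 1) * ∫ ω, Metric.infDist (iterate l ω (t + 1)) A ^ 2 ∂(playLaw σ τ) ≤ K := by
  choose P hP using exists_isProj hne hc hA
  obtain ⟨M, h0, hM⟩ := exists_norm_le_of_finite l
  obtain ⟨z, hz⟩ := hne
  set R := 2 * M + ‖z‖
  have hR : ∀ ω t, ‖iterate l ω t - P (iterate l ω t)‖ ≤ R := fun ω t =>
    ((hP _).2 z hz).trans ((norm_sub_le _ _).trans
      (add_le_add_left (norm_iterate_le h0 hM ω t) _))
  have hint : ∀ n, Integrable (fun ω => Metric.infDist (iterate l ω n) A ^ 2) (playLaw σ τ) :=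
    fun n => DependsOn.integrable_playLaw σ τ
      (dependsOn_comp_iterate l (fun y => Metric.infDist y A ^ 2) n)
  -- `R ^ 2` covers the first round; the other term is the error constant of the one-step
  -- inequality.
  refine ⟨R ^ 2 + (6 * M * R + 9 * M ^ 2), fun t => ?_⟩
  have hC : 0 ≤ 6 * M * R + 9 * M ^ 2 := by positivity
  set C := 6 * M * R + 9 * M ^ 2
  induction t with
  | zero =>
    have h1 : ∫ ω, Metric.infDist (iterate l ω 1) A ^ 2 ∂(playLaw σ τ) ≤
        ∫ _, R ^ 2 ∂(playLaw σ τ) := by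
      refine integral_mono (hint 1) (integrable_const _) fun ω => ?_
      simp only [(hP _).infDist_eq]
      exact pow_le_pow_left₀ (norm_nonneg _) (hR ω 1) 2
    simp only [integral_const, probReal_univ, one_smul] at h1
    simp only [zero_add, Nat.cast_zero, one_mul]
    linarith
  | succ t ih =>
    set φ : (ℕ → Round U₁ U₂ D) → Round U₁ U₂ D → ℝ := fun ω r =>
      inner ℝ (iterate l ω (t + 1) - P (iterate l ω (t + 1)))
        (roundLoss l r - P (iterate l ω (t + 1)))
    have hφ : DependsOn φ (Set.Iic t) := fun ω ω' h => by
      simp only [φ, iterate_succ_congr l h]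
    have hφi : Integrable (fun ω => φ ω (ω (t + 1))) (playLaw σ τ) :=
      DependsOn.integrable_playLaw σ τ (n := t + 1) fun ω ω' h => by
        rw [hφ fun i hi => h i (le_trans hi (Nat.le_succ t)), h (t + 1) (Set.mem_Iic.2 le_rfl)]
    have hneg : ∫ ω, φ ω (ω (t + 1)) ∂(playLaw σ τ) ≤ 0 := by
      rw [integral_next_round σ τ t hφ]
      exact integral_nonpos fun ω =>
        hσ.sum_inner_nonpos hA hq ω (Nat.succ_pos t) (hP _) _
    have h1 : ∫ ω, ((t : ℝ) + 2) * Metric.infDist (iterate l ω (t + 2)) A ^ 2 ∂(playLaw σ τ) ≤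
        ∫ ω, (t * Metric.infDist (iterate l ω (t + 1)) A ^ 2 + 2 * φ ω (ω (t + 1))
          + C / (t + 1)) ∂(playLaw σ τ) := by
      refine integral_mono ((hint _).const_mul _)
        ((((hint _).const_mul _).add (hφi.const_mul _)).add (integrable_const _)) fun ω => ?_
      exact sq_infDist_iterate_le h0 hM ω t (hP _) (hR ω _)
    have i12 : Integrable (fun ω => t * Metric.infDist (iterate l ω (t + 1)) A ^ 2 +
        2 * φ ω (ω (t + 1))) (playLaw σ τ) := ((hint _).const_mul _).add (hφi.const_mul _)
    rw [integral_add i12 (integrable_const _),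
      integral_add ((hint _).const_mul _) (hφi.const_mul _), integral_const_mul,
      integral_const_mul, integral_const_mul, integral_const, probReal_univ, one_smul] at h1
    set e := ∫ ω, Metric.infDist (iterate l ω (t + 1)) A ^ 2 ∂(playLaw σ τ)
    have ht : (0 : ℝ) < (t : ℝ) + 1 := by positivity
    -- The induction bounds `(t + 1) * e`, but only `t * e` occurs; the spare `(R ^ 2 + C) / (t +
    -- 1)` absorbs the error. With `t + 1` in place of `t` the errors would add up to a logarithm.
    have h2 : (t : ℝ) * e + C / (t + 1) ≤ R ^ 2 + C := by
      have h3 : (t : ℝ) * e ≤ t * ((R ^ 2 + C) / (t + 1)) :=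
        mul_le_mul_of_nonneg_left ((le_div_iff₀' ht).2 ih) (Nat.cast_nonneg t)
      have h4 : (t : ℝ) * ((R ^ 2 + C) / (t + 1)) + (R ^ 2 + C) / (t + 1) = R ^ 2 + C := by
        field_simp
      have h5 : C / ((t : ℝ) + 1) ≤ (R ^ 2 + C) / (t + 1) :=
        div_le_div_of_nonneg_right (by nlinarith) ht.le
      linarith
    push_cast
    rw [show (t : ℝ) + 1 + 1 = t + 2 by ring]
    linarith

theorem Follows.approaches [CompleteSpace E] {l : U₁ → U₂ → D → E}
    {A : Set E} (hne : A.Nonempty) (hc : IsClosed A) (hA : Convex ℝ A)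
    {q : E → stdSimplex ℝ U₁} (hq : ∀ Λ, Enforces l A Λ (q Λ)) {σ : Strategy U₁ U₂ D}
    (hσ : Follows l A q σ) : Approaches l A σ := by
  intro τ
  obtain ⟨M, h0, hM⟩ := exists_norm_le_of_finite l
  obtain ⟨K, hK⟩ := hσ.exists_integral_sq_infDist_le hne hc hA hq τ
  have hint : ∀ n, Integrable (fun ω => Metric.infDist (iterate l ω n) A ^ 2) (playLaw σ τ) :=
    fun n => DependsOn.integrable_playLaw σ τ
      (dependsOn_comp_iterate l (fun y => Metric.infDist y A ^ 2) n)
  have hsum : Summable fun k : ℕ =>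
      ∫ ω, Metric.infDist (iterate l ω ((k + 1) ^ 2)) A ^ 2 ∂(playLaw σ τ) := by
    have hb : Summable fun k : ℕ => K * (1 / ((k + 1 : ℕ) : ℝ) ^ 2) :=
      ((summable_nat_add_iff (f := fun k : ℕ => 1 / (k : ℝ) ^ 2) 1).2
        (Real.summable_one_div_nat_pow.2 one_lt_two)).mul_left K
    refine Summable.of_nonneg_of_le (fun k => integral_nonneg fun ω => sq_nonneg _)
      (fun k => ?_) hb
    have := hK ((k + 1) ^ 2 - 1)
    rw [← Nat.cast_add_one, Nat.sub_add_cancel (Nat.one_le_pow _ _ k.succ_pos)] at this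
    rw [mul_one_div, le_div_iff₀' (by positivity)]
    exact_mod_cast this
  filter_upwards [ae_tendsto_zero_of_summable_integral (fun k => hint ((k + 1) ^ 2))
    (fun k ω => sq_nonneg _) hsum] with ω hω
  refine tendsto_infDist_of_squares (by positivity : 0 ≤ 3 * M)
    (norm_iterate_succ_sub_le h0 hM ω) ?_
  have := (Real.continuous_sqrt.tendsto 0).comp hω
  simpa [Function.comp_def, Real.sqrt_sq, Metric.infDist_nonneg] using this

end Sufficiency

/-! ### Necessity: a best-responding adversary. -/

section Necessity

variable {U₁ U₂ D E : Type*} [NormedAddCommGroup E] [InnerProductSpace ℝ E]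

theorem add_two_smul_iterate_sub (l : U₁ → U₂ → D → E) (ω : ℕ → Round U₁ U₂ D) (t : ℕ) :
    ((t : ℝ) + 2) • iterate l ω (t + 2) - iterate l ω (t + 1) =
      (((t : ℝ) + 1) • iterate l ω (t + 1) - iterate l ω t) + roundLoss l (ω (t + 1)) := by
  rw [iterate_add_two, smul_add, smul_smul, mul_inv_cancel₀ (by positivity)]
  module

theorem IsProj.inner_le {A : Set E} {y p Λ : E} (h : IsProj A y p) {w : ℝ}
    (hw : supportFn A Λ ≤ w) : inner ℝ Λ y ≤ w + ‖Λ‖ * Metric.infDist y A := by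
  have h1 : inner ℝ Λ p ≤ w := EReal.coe_le_coe_iff.1
    ((le_iSup₂ (f := fun z (_ : z ∈ A) => ((inner ℝ Λ z : ℝ) : EReal)) p h.1).trans hw)
  have h2 := real_inner_le_norm Λ (y - p)
  rw [inner_sub_right] at h2
  rw [h.infDist_eq]
  linarith

theorem exists_supportFn_eq_coe {A : Set E} (hne : A.Nonempty) {Λ : E} {c : ℝ}
    (h : supportFn A Λ < c) : ∃ w : ℝ, supportFn A Λ = w := by
  obtain ⟨z, hz⟩ := hne
  have h1 : ((inner ℝ Λ z : ℝ) : EReal) ≤ supportFn A Λ :=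
    le_iSup₂ (f := fun z (_ : z ∈ A) => ((inner ℝ Λ z : ℝ) : EReal)) z hz
  exact ⟨_, (EReal.coe_toReal (h.trans (EReal.coe_lt_top c)).ne
    ((EReal.bot_lt_coe _).trans_le h1).ne').symm⟩

variable [Fintype U₁]

/-- If no mixed action of player 1 enforces the bound `w`, the other side can always answer with
a loss that exceeds `w` by a fixed margin. -/
theorem exists_uniform_answer [Nonempty U₁] [Finite U₂] [Finite D] [Nonempty U₂] [Nonempty D]
    (l : U₁ → U₂ → D → E) (Λ : E) {w : ℝ}
    (h : ∀ q : stdSimplex ℝ U₁, ∃ s : U₂ × D, w < inner ℝ Λ (mixedLoss l q s.1 s.2)) :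
    ∃ m > w, ∀ q : stdSimplex ℝ U₁, ∃ s : U₂ × D, m ≤ inner ℝ Λ (mixedLoss l q s.1 s.2) := by
  classical
  have := Fintype.ofFinite U₂
  have := Fintype.ofFinite D
  let G : stdSimplex ℝ U₁ → ℝ := fun q =>
    Finset.univ.sup' Finset.univ_nonempty fun s : U₂ × D => inner ℝ Λ (mixedLoss l q s.1 s.2)
  have hG : Continuous G := by
    refine Continuous.finset_sup'_apply _ fun s _ => ?_
    simp only [mixedLoss, inner_sum, inner_smul_right]
    exact continuous_finsetSum _ fun a _ =>
      ((continuous_apply a).comp continuous_subtype_val).mul continuous_const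
  have : CompactSpace (stdSimplex ℝ U₁) := isCompact_iff_compactSpace.1 (isCompact_stdSimplex ℝ U₁)
  have : Nonempty (stdSimplex ℝ U₁) :=
    ⟨⟨_, single_mem_stdSimplex ℝ (Classical.arbitrary U₁)⟩⟩
  obtain ⟨q₀, -, hq₀⟩ := isCompact_univ.exists_isMinOn Set.univ_nonempty hG.continuousOn
  refine ⟨G q₀, ?_, fun q => ?_⟩
  · obtain ⟨s, hs⟩ := h q₀
    exact hs.trans_le (Finset.le_sup' (fun s : U₂ × D => inner ℝ Λ (mixedLoss l q₀ s.1 s.2))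
      (Finset.mem_univ s))
  · obtain ⟨s, -, hs⟩ := Finset.exists_mem_eq_sup' (Finset.univ_nonempty (α := U₂ × D))
      fun s => inner ℝ Λ (mixedLoss l q s.1 s.2)
    exact ⟨s, hs ▸ hq₀ (Set.mem_univ q)⟩

variable [Fintype U₂] [Fintype D]

theorem integrable_inner_iterate (l : U₁ → U₂ → D → E) (Λ : E) (σ : Strategy U₁ U₂ D)
    (τ : Adversary U₁ U₂ D) (t : ℕ) :
    Integrable (fun ω => inner ℝ Λ (iterate l ω t)) (playLaw σ τ) :=
  DependsOn.integrable_playLaw σ τ (dependsOn_comp_iterate l (fun y => inner ℝ Λ y) t)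

theorem integrable_inner_roundLoss (l : U₁ → U₂ → D → E) (Λ : E) (σ : Strategy U₁ U₂ D)
    (τ : Adversary U₁ U₂ D) (t : ℕ) :
    Integrable (fun ω => inner ℝ Λ (roundLoss l (ω t))) (playLaw σ τ) :=
  DependsOn.integrable_playLaw σ τ (n := t) fun _ _ h => by rw [h t (Set.mem_Iic.2 le_rfl)]

/-- The adversary that answers the current mixed action of player 1 by `br`. -/
noncomputable def bestResponse (σ : Strategy U₁ U₂ D) (br : stdSimplex ℝ U₁ → U₂ × D) :
    Adversary U₁ U₂ D :=
  open Classical in fun t h => ⟨Pi.single (br (σ t h)) 1, single_mem_stdSimplex ℝ _⟩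

/-- Given the past, the adversary's law is a point mass at `br q`, so the conditional mean is `Λ ·
l(q, br q)`. The first round has no past to condition on and is left out. -/
theorem le_integral_inner_roundLoss {l : U₁ → U₂ → D → E} {Λ : E} {m : ℝ} (σ : Strategy U₁ U₂ D)
    {br : stdSimplex ℝ U₁ → U₂ × D}
    (h : ∀ q, m ≤ inner ℝ Λ (mixedLoss l q (br q).1 (br q).2)) (t : ℕ) :
    m ≤ ∫ ω, inner ℝ Λ (roundLoss l (ω (t + 1))) ∂(playLaw σ (bestResponse σ br)) := by
  classical
  have h1 : 0 ≤ ∫ ω, (inner ℝ Λ (roundLoss l (ω (t + 1))) - m)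
      ∂(playLaw σ (bestResponse σ br)) := by
    rw [integral_next_round σ _ t (φ := fun _ r => inner ℝ Λ (roundLoss l r) - m)
      fun _ _ _ => rfl]
    refine integral_nonneg fun ω => ?_
    simp only [mul_sub, Finset.sum_sub_distrib, ← Finset.sum_mul, sum_mul_eq_one, one_mul]
    refine sub_nonneg.2 ((h (σ (t + 1) fun i => ω i)).trans_eq ?_)
    simp [bestResponse, mixedLoss, inner_sum, inner_smul_right, Pi.single_apply, roundLoss]
  rw [integral_sub (integrable_inner_roundLoss l Λ σ _ _) (integrable_const _)] at h1
  simpa using h1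

theorem le_integral_inner_iterate {l : U₁ → U₂ → D → E} {Λ : E} {m : ℝ} (σ : Strategy U₁ U₂ D)
    {br : stdSimplex ℝ U₁ → U₂ × D}
    (h : ∀ q, m ≤ inner ℝ Λ (mixedLoss l q (br q).1 (br q).2)) :
    ∃ C : ℝ, ∀ t : ℕ, m - C / (t + 1) ≤
      ∫ ω, inner ℝ Λ (iterate l ω (t + 1)) ∂(playLaw σ (bestResponse σ br)) := by
  obtain ⟨M, h0, hM⟩ := exists_norm_le_of_finite l
  set μ := playLaw σ (bestResponse σ br)
  set e : ℕ → ℝ := fun t => ∫ ω, inner ℝ Λ (iterate l ω t) ∂μ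
  have hi := integrable_inner_iterate l Λ σ (bestResponse σ br)
  have hrec : ∀ t : ℕ, ((t : ℝ) + 1) * e (t + 1) - e t + m ≤ (t + 2) * e (t + 2) - e (t + 1) := by
    intro t
    have h1 : ∫ ω, (((t : ℝ) + 2) * inner ℝ Λ (iterate l ω (t + 2)) -
        inner ℝ Λ (iterate l ω (t + 1))) ∂μ = ∫ ω, ((((t : ℝ) + 1) *
        inner ℝ Λ (iterate l ω (t + 1)) - inner ℝ Λ (iterate l ω t)) +
        inner ℝ Λ (roundLoss l (ω (t + 1)))) ∂μ := by
      refine integral_congr_ae (.of_forall fun ω => ?_)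
      simpa only [inner_sub_right, inner_smul_right, inner_add_right] using
        congrArg (inner ℝ Λ) (add_two_smul_iterate_sub l ω t)
    have h2 : Integrable (fun ω => ((t : ℝ) + 1) * inner ℝ Λ (iterate l ω (t + 1)) -
        inner ℝ Λ (iterate l ω t)) μ := ((hi _).const_mul _).sub (hi _)
    rw [integral_sub ((hi _).const_mul _) (hi _),
      integral_add h2 (integrable_inner_roundLoss l Λ σ _ _),
      integral_sub ((hi _).const_mul _) (hi _), integral_const_mul, integral_const_mul] at h1
    linarith [le_integral_inner_roundLoss σ h t]
  -- Expected telescoped sum: each round after the first contributes at least `m`, and the first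
  -- contributes `e 1 - e 0`.
  have hlow : ∀ t : ℕ, t * m + (e 1 - e 0) ≤ ((t : ℝ) + 1) * e (t + 1) - e t := by
    intro t
    induction t with
    | zero => simp
    | succ t ih =>
      have := hrec t
      push_cast
      rw [show (t : ℝ) + 1 + 1 = t + 2 by ring]
      linarith
  have hbd : ∀ t, -(‖Λ‖ * (2 * M)) ≤ e t := by
    intro t
    have h1 : ∫ _, -(‖Λ‖ * (2 * M)) ∂μ ≤ e t := by
      refine integral_mono (integrable_const _) (hi t) fun ω => ?_
      exact neg_le_of_abs_le ((abs_real_inner_le_norm _ _).trans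
        (mul_le_mul_of_nonneg_left (norm_iterate_le h0 hM ω t) (norm_nonneg _)))
    simpa using h1
  refine ⟨m - (e 1 - e 0) + ‖Λ‖ * (2 * M), fun t => ?_⟩
  have ht : (0 : ℝ) < (t : ℝ) + 1 := by positivity
  rw [sub_le_iff_le_add, ← sub_le_iff_le_add', le_div_iff₀ ht]
  change (m - e (t + 1)) * _ ≤ _
  linarith [hlow t, hbd t]

theorem Approachable.exists_enforces [CompleteSpace E] [Nonempty U₁] [Nonempty U₂] [Nonempty D]
    {l : U₁ → U₂ → D → E} {A : Set E} (hne : A.Nonempty) (hc : IsClosed A) (hA : Convex ℝ A)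
    (h : Approachable l A) (Λ : E) : ∃ q : stdSimplex ℝ U₁, Enforces l A Λ q := by
  obtain ⟨σ, hσ⟩ := h
  choose P hP using exists_isProj hne hc hA
  by_contra! hcon
  simp only [Enforces, not_forall, not_le] at hcon
  have : Nonempty (stdSimplex ℝ U₁) := by
    classical
    exact ⟨⟨_, single_mem_stdSimplex ℝ (Classical.arbitrary U₁)⟩⟩
  -- A violated inequality already rules out `w_A(Λ) = +∞`, and `A` nonempty rules out `-∞`.
  obtain ⟨w, hw⟩ : ∃ w : ℝ, supportFn A Λ = w := by
    obtain ⟨b, d, hbd⟩ := hcon (Classical.arbitrary _)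
    exact exists_supportFn_eq_coe hne hbd
  obtain ⟨m, hm, hbr⟩ := exists_uniform_answer l Λ (w := w) fun q => by
    obtain ⟨b, d, hbd⟩ := hcon q
    exact ⟨(b, d), EReal.coe_lt_coe_iff.1 (hw ▸ hbd)⟩
  choose br hbr using hbr
  obtain ⟨C, hC⟩ := le_integral_inner_iterate σ hbr
  obtain ⟨M, h0, hM⟩ := exists_norm_le_of_finite l
  obtain ⟨z, hz⟩ := hne
  set μ := playLaw σ (bestResponse σ br)
  have hint : ∀ t, Integrable (fun ω => Metric.infDist (iterate l ω t) A) μ := fun t =>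
    DependsOn.integrable_playLaw σ _ (dependsOn_comp_iterate l (fun y => Metric.infDist y A) t)
  have hlim : Tendsto (fun t => ∫ ω, Metric.infDist (iterate l ω t) A ∂μ) atTop (𝓝 0) := by
    have := tendsto_integral_of_dominated_convergence (μ := μ) (fun _ => 2 * M + ‖z‖)
      (fun t => (hint t).1) (integrable_const _) (fun t => .of_forall fun ω => ?_)
      (hσ (bestResponse σ br))
    · simpa using this
    · rw [Real.norm_of_nonneg Metric.infDist_nonneg]
      refine (Metric.infDist_le_dist_of_mem hz).trans ?_
      rw [dist_eq_norm]
      exact (norm_sub_le _ _).trans (add_le_add_left (norm_iterate_le h0 hM ω t) _)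
  have hle : ∀ t : ℕ, m - C / ((t : ℝ) + 1) ≤
      w + ‖Λ‖ * ∫ ω, Metric.infDist (iterate l ω (t + 1)) A ∂μ := by
    intro t
    have h1 : ∫ ω, inner ℝ Λ (iterate l ω (t + 1)) ∂μ ≤
        ∫ ω, (w + ‖Λ‖ * Metric.infDist (iterate l ω (t + 1)) A) ∂μ :=
      integral_mono (integrable_inner_iterate l Λ σ _ _)
        ((integrable_const _).add ((hint _).const_mul _)) fun ω => (hP _).inner_le hw.le
    rw [integral_add (integrable_const _) ((hint _).const_mul _), integral_const_mul,
      integral_const, probReal_univ, one_smul] at h1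
    exact (hC t).trans h1
  have hl : Tendsto (fun t : ℕ => m - C / ((t : ℝ) + 1)) atTop (𝓝 m) := by
    have := ((tendsto_const_div_atTop_nhds_zero_nat C).comp (tendsto_add_atTop_nat 1)).const_sub m
    simpa [Function.comp_def] using this
  have hr : Tendsto (fun t : ℕ => w + ‖Λ‖ * ∫ ω, Metric.infDist (iterate l ω (t + 1)) A ∂μ)
      atTop (𝓝 w) := by
    have := ((hlim.comp (tendsto_add_atTop_nat 1)).const_mul ‖Λ‖).const_add w
    simpa [Function.comp_def] using this
  exact hm.not_ge (le_of_tendsto_of_tendsto' hl hr hle)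

end Necessity

end PerturbedGame

theorem mainTheorem1 {U₁ U₂ D : Type*} [Fintype U₁] [Nonempty U₁] [Fintype U₂] [Nonempty U₂]
    [Fintype D] [Nonempty D] {L : ℕ} (l : U₁ → U₂ → D → EuclideanSpace ℝ (Fin L))
    (A : Set (EuclideanSpace ℝ (Fin L))) (hne : A.Nonempty) (hclosed : IsClosed A)
    (hconvex : Convex ℝ A) :
    (PerturbedGame.Approachable l A ↔
      ∀ Λ : EuclideanSpace ℝ (Fin L), ∃ q : stdSimplex ℝ U₁, PerturbedGame.Enforces l A Λ q) ∧
    ∀ q : EuclideanSpace ℝ (Fin L) → stdSimplex ℝ U₁,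
      (∀ Λ, PerturbedGame.Enforces l A Λ (q Λ)) →
        (∃ σ : PerturbedGame.Strategy U₁ U₂ D, PerturbedGame.Follows l A q σ) ∧
        ∀ σ : PerturbedGame.Strategy U₁ U₂ D,
          PerturbedGame.Follows l A q σ → PerturbedGame.Approaches l A σ := by
  have : Nonempty (PerturbedGame.Round U₁ U₂ D) :=
    ⟨⟨Classical.arbitrary _, Classical.arbitrary _, Classical.arbitrary _⟩⟩
  have hex := fun q => PerturbedGame.exists_follows hne hclosed hconvex l q
  refine ⟨⟨fun h => h.exists_enforces hne hclosed hconvex, fun h => ?_⟩,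
    fun q hq => ⟨hex q, fun σ hσ => hσ.approaches hne hclosed hconvex hq⟩⟩
  choose q hq using h
  obtain ⟨σ, hσ⟩ := hex q
  exact ⟨σ, hσ.approaches hne hclosed hconvex hq⟩
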